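/- Let $N_A,N_B\ge 0$, $t\ge 1$ and $K\ge 0$ be integers and put $d_A=2^{N_A}$, $d_B=2^{N_B}$. A system $A$ of $N_A$ qubits, initially in $|0\rangle_A$, interacts in $t$ steps with a bath $B$ of $N_B$ qubits, initially in $|0\rangle_B$: in step $k$ a random unitary $U_k$ acts on $AB$ and then $B$ is measured in the computational basis, with outcome $z_k$; before each later step the bath is either reset to $|0\rangle_B$ or left in the measured state (the choice being fixed in advance for each step). After the last step $A$ is also measured in the computational basis, with outcome $x$. Thus, with $U_k$ acting on $A$ and on its own copy $B_k$ of the bath, the joint distribution of the outcomes is $$P_{\boldsymbol U}[\boldsymbol z,x]=\bigl|\langle z_1|_{B_1}\cdots\langle z_t|_{B_t}\langle x|_A\,U_t\cdots U_1\,|0\rangle_A|b_1\rangle_{B_1}\cdots|b_t\rangle_{B_t}\bigr|^2 ,$$ where $b_1=0$, and for $k\ge 2$ one has $b_k=0$ if the bath is reset before step $k$ and $b_k=z_{k-1}$ otherwise. The unitaries $U_1,\dots,U_t$ are independent, and the law of each $U_k$ is a unitary $K$-design, i.e. its moment operator $\mathbb E[U_k^{\otimes K}\otimes (U_k^{*})^{\otimes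 K}]$ equals that of the Haar measure on the unitary group of dimension $d_Ad_B$. Let $$Z^{(K)}_{\mathrm{HRCS}}(t)=\mathbb E_{U_1,\dots,U_t}\sum_{\boldsymbol z,x}P_{\boldsymbol U}[\boldsymbol z,x]^K,\qquad Z^{(K)}_{\mathrm H}(N)=\mathbb E_{U\sim\mathrm{Haar}(2^N)}\sum_{y}|\langle y|U|0\rangle|^{2K}.$$ Then $Z^{(K)}_{\mathrm H}(N)=K!\,(2^N)!/(2^N+K-1)!$ for every integer $N\ge 0$, and $$Z^{(K)}_{\mathrm{HRCS}}(t)=K!\,d_A\,d_B^{\,t}\left(\frac{(d_A+K-1)!}{(d_A-1)!}\right)^{t-1}\left(\frac{(d_Ad_B-1)!}{(d_Ad_B+K-1)!}\right)^{t}.$$ Moreover $$Z^{(K)}_{\mathrm{HRCS}}(t)=Z^{(K)}_{\mathrm H}(N_A+tN_B)\,\exp\left[K(K-1)\,\frac{t(1-d_B^{-1})+d_B^{-t}-1}{2d_A}+r\right],\qquad |r|\le \frac{C_K\,t}{d_A^2},$$ where $C_K$ depends only on $K$; in particular, for fixed $K$ and $t$, $r=O(1/d_A^2)$ as $d_A\to\infty$,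 uniformly in $N_B$ and in the chosen designs. -/

import Mathlib

open MeasureTheory
open scoped Nat ComplexConjugate

namespace HRCS

noncomputable section

/-- The group of unitary operators on the Hilbert space with orthonormal basis `ι`. -/
abbrev UGroup (ι : Type) [Fintype ι] [DecidableEq ι] : Type :=
  Matrix.unitaryGroup ι ℂ

/-- Bit strings of length `N`: they label the computational basis of `N` qubits; the string `0`
labels the trivial state. -/
abbrev Bits (N : ℕ) : Type := Fin N → Fin 2

section Haar

variable (ι : Type) [Fintype ι] [DecidableEq ι]

instance instMeasurableSpaceUGroup : MeasurableSpace (UGroup ι) := borel _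

instance instBorelSpaceUGroup : BorelSpace (UGroup ι) := ⟨rfl⟩

instance instCompactSpaceUGroup : CompactSpace (UGroup ι) := by
  apply isCompact_iff_compactSpace.mp
  have hK : IsCompact (Set.pi Set.univ fun _ : ι => Set.pi Set.univ fun _ : ι =>
      Metric.closedBall (0 : ℂ) 1) :=
    isCompact_univ_pi fun _ => isCompact_univ_pi fun _ => isCompact_closedBall 0 1
  have hcl : IsClosed ((Matrix.unitaryGroup ι ℂ : Submonoid (Matrix ι ι ℂ)) :
      Set (Matrix ι ι ℂ)) := isClosed_unitary
  refine IsCompact.of_isClosed_subset hK hcl ?_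
  intro U hU i _ j _
  simpa using entry_norm_bound_of_unitary hU i j

/-- The Haar probability measure on the unitary group. -/
def haarU : Measure (UGroup ι) := Measure.haarMeasure ⊤

instance instIsProbabilityMeasureHaarU : IsProbabilityMeasure (haarU ι) :=
  ⟨by simpa [haarU] using
    Measure.haarMeasure_self (K₀ := (⊤ : TopologicalSpace.PositiveCompacts (UGroup ι)))⟩

variable {ι}

/-- An ensemble `ν` of random unitaries is a `K`-design if its `K`-th moment operator
`𝔼 [U^{⊗K} ⊗ (U^*)^{⊗K}]` is the one of the Haar ensemble (compared entry by entry). -/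
def IsDesign (K : ℕ) (ν : Measure (UGroup ι)) : Prop :=
  ∀ i j k l : Fin K → ι,
    ∫ U : UGroup ι, (∏ a, U.1 (i a) (j a)) * ∏ a, conj (U.1 (k a) (l a)) ∂ν =
      ∫ U : UGroup ι, (∏ a, U.1 (i a) (j a)) * ∏ a, conj (U.1 (k a) (l a)) ∂(haarU ι)

end Haar

/-- The `K`-th power sum of the computational-basis measurement of an `N`-qubit Haar random state
`U|0⟩`, averaged over the Haar ensemble. -/
def haarPowerSum (K N : ℕ) : ℝ :=
  ∫ U : UGroup (Bits N), ∑ x, (‖U.1 x 0‖ ^ 2) ^ K ∂(haarU (Bits N))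

section Circuit

variable {NA NB t : ℕ}

/-- The operator on `A B_1 ⋯ B_t` that acts as the unitary `U` on the system `A` and the `k`-th
bath register `B_k`, and as the identity on every other bath register. -/
def liftOp (k : Fin t) (U : UGroup (Bits NA × Bits NB)) :
    Matrix (Bits NA × (Fin t → Bits NB)) (Bits NA × (Fin t → Bits NB)) ℂ :=
  fun p q => if ∀ j, j ≠ k → p.2 j = q.2 j then U.1 (p.1, p.2 k) (q.1, q.2 k) else 0

/-- The global operator `U_t ⋯ U_2 U_1` on `A B_1 ⋯ B_t`; the first step is the one that
acts first. -/
def globalOp (U : Fin t → UGroup (Bits NA × Bits NB)) :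
    Matrix (Bits NA × (Fin t → Bits NB)) (Bits NA × (Fin t → Bits NB)) ℂ :=
  (List.ofFn fun k => liftOp k (U k)).reverse.prod

/-- The basis state in which the bath enters step `k`, given the mid-circuit outcomes `z`: the
trivial state at the first step and whenever the bath is reset before step `k`, and otherwise the
state left behind by the previous measurement. -/
def bathInput (reset : Fin t → Bool) (z : Fin t → Bits NB) (k : Fin t) : Bits NB :=
  if k.val = 0 ∨ reset k = true then 0 else z ⟨k.val - 1, by omega⟩

/-- The joint probability `|⟨z_1| ⋯ ⟨z_t| ⟨x| U_t ⋯ U_1 |0⟩_A |b_1⟩ ⋯ |b_t⟩|²` of the bath outcomes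
`z_1, …, z_t` and the final system outcome `x`, where `b_k` is the input state of the bath at
step `k` (so `b_k = 0` for all `k` if the bath is always reset). -/
def jointProb (reset : Fin t → Bool) (U : Fin t → UGroup (Bits NA × Bits NB))
    (z : Fin t → Bits NB) (x : Bits NA) : ℝ :=
  ‖globalOp U (x, z) (0, bathInput reset z)‖ ^ 2

/-- The `K`-th power sum of the joint distribution, averaged over independent unitaries
`U_1, …, U_t`, where `U_k` has law `ν k`. -/
def powerSum (K : ℕ) (reset : Fin t → Bool)
    (ν : Fin t → Measure (UGroup (Bits NA × Bits NB))) : ℝ :=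
  ∫ U, ∑ z : Fin t → Bits NB, ∑ x : Bits NA, jointProb reset U z x ^ K ∂(Measure.pi ν)

end Circuit

end

end HRCS

namespace HRCS

noncomputable section

/-! ### Unitary invariance of Haar and Lebesgue measure -/

section UnitaryInvariance

variable {ι : Type} [Fintype ι] [DecidableEq ι]

/-! For fixed outcomes the amplitude is a product of blocks of the `U_k`, one per step. If `U` is
Haar, the `K`-th moment of the weight of `U v` on a set `S` of outcomes depends on `v` only through
its norm: it is `‖v‖^(2K)` times a ratio of rising factorials of `|S|` and of the dimension
(`integral_haar_partial_norm_sq`). The constant comes from averaging `v` over a Gaussian, for which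
both `U v` and `v` have the same explicit moments. The weight is a polynomial of degree `K` in `U`
and in its conjugate, so a `K`-design gives the same value.

Hence the steps decouple, whatever state the bath enters in. Every step but the last leaves the
`d_A` system states unresolved and contributes the rising factorial of `d_A` over that of `d_A d_B`;
the last one fixes `x` and has `K!` on top (`integral_branchOp_moment`). All outcomes contribute
equally, so the power sum is a count times this product. The comparison with Haar states takes
logarithms: that of the rising factorial of `m` is `K log m + K(K-1)/(2m) + O(1/m²)`. -/

instance isMulRightInvariant_haarU : (haarU ι).IsMulRightInvariant := by
  have hH : (haarU ι).IsHaarMeasure := by unfold haarU; infer_instance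
  refine ⟨fun g => ?_⟩
  -- A right translate is again a Haar probability measure, so uniqueness identifies the two.
  have : IsProbabilityMeasure ((haarU ι).map (· * g)) :=
    Measure.isProbabilityMeasure_map (by fun_prop)
  exact Measure.isHaarMeasure_eq_of_isProbabilityMeasure _ _

/-- Unitary matrices preserve the sum of squared moduli of the coordinates. -/
lemma sum_norm_sq_unitary_mulVec (U : UGroup ι) (v : ι → ℂ) :
    ∑ i, ‖(U.1.mulVec v) i‖ ^ 2 = ∑ i, ‖v i‖ ^ 2 := by
  have key : ∀ w : ι → ℂ, ((∑ i, ‖w i‖ ^ 2 : ℝ) : ℂ) = dotProduct (star w) w := by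
    intro w
    simp [dotProduct, Complex.conj_mul']
  apply Complex.ofReal_injective
  rw [key, key, Matrix.star_mulVec, Matrix.dotProduct_mulVec, Matrix.vecMul_vecMul,
    ← Matrix.star_eq_conjTranspose, Unitary.coe_star_mul_self, Matrix.vecMul_one]

/-- Every vector of unit length is the image of a given basis vector under some unitary. -/
lemma exists_unitary_col (i₀ : ι) (v : ι → ℂ) (hv : ∑ i, ‖v i‖ ^ 2 = 1) :
    ∃ V : UGroup ι, ∀ i, V.1 i i₀ = v i := by
  -- Only the value at `i₀` matters: the family is restricted to `{i₀}` before being extended to a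
  -- basis.
  let w : ι → EuclideanSpace ℂ ι := fun _ => WithLp.toLp 2 v
  have hw : Orthonormal ℂ (({i₀} : Set ι).domRestrict w) := by
    constructor
    · intro i
      simp [w, EuclideanSpace.norm_eq, Set.domRestrict, hv]
    · intro i j hij
      exact absurd (Subsingleton.elim i j) hij
  obtain ⟨b, hb⟩ := hw.exists_orthonormalBasis_extension_of_card_eq (by simp)
  refine ⟨⟨_, (EuclideanSpace.basisFun ι ℂ).toMatrix_orthonormalBasis_mem_unitary b⟩, fun i => ?_⟩
  simp [Module.Basis.toMatrix_apply, hb i₀ rfl, w]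

/-- The Lebesgue measure on `ℂ^ι` is invariant under unitary matrices. -/
lemma integral_unitary_mulVec (U : UGroup ι) (f : (ι → ℂ) → ℝ) (hf : Continuous f) :
    ∫ v, f (U.1.mulVec v) = ∫ v, f v := by
  let L : (ι → ℂ) →ₗ[ℝ] (ι → ℂ) := (Matrix.toLin' U.1).restrictScalars ℝ
  have hdet : LinearMap.det L = 1 := by
    have h1 : (star U.1.det) * U.1.det = 1 := (Matrix.det_of_mem_unitary U.2).1
    -- The real determinant of a complex-linear map is the squared modulus of its complex
    -- determinant.
    have h2 : LinearMap.det L = Complex.normSq U.1.det := by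
      simp [L, LinearMap.det_restrictScalars, Algebra.norm_complex_apply]
    rw [h2]
    apply Complex.ofReal_injective
    rw [Complex.normSq_eq_conj_mul_self]
    simpa using h1
  have hmap : Measure.map L volume = (volume : Measure (ι → ℂ)) := by
    rw [Measure.map_linearMap_addHaar_eq_smul_addHaar _ (by simp [hdet])]
    simp [hdet]
  have hL : Continuous L := LinearMap.continuous_of_finiteDimensional L
  conv_rhs => rw [← hmap]
  rw [integral_map hL.aemeasurable hf.aestronglyMeasurable]
  rfl

end UnitaryInvariance

/-! ### Gaussian moments -/

section Gaussian

lemma integral_norm_pow_mul_exp (k : ℕ) :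
    ∫ z : ℂ, (‖z‖ ^ 2) ^ k * Real.exp (-‖z‖ ^ 2) = Real.pi * k ! := by
  have h := Complex.integral_rpow_mul_exp_neg_rpow (p := 2) (q := 2 * k) (by norm_num)
    (by have : (0 : ℝ) ≤ k := by positivity
        linarith)
  have h2 : ((2 * k + 2) / 2 : ℝ) = k + 1 := by ring
  rw [h2, Real.Gamma_nat_eq_factorial, mul_div_cancel_left₀ _ (two_ne_zero)] at h
  rw [← h]
  congr 1 with z
  rw [← pow_mul]
  norm_cast

lemma integrable_norm_pow_mul_exp (k : ℕ) :
    Integrable fun z : ℂ => (‖z‖ ^ 2) ^ k * Real.exp (-‖z‖ ^ 2) := by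
  -- A non-integrable function would have integral `0` by convention.
  apply Integrable.of_integral_ne_zero
  rw [integral_norm_pow_mul_exp]
  positivity

variable {ι : Type} [Fintype ι] [DecidableEq ι]

/-- The unnormalized standard Gaussian density on `ℂ^ι`. -/
def gaussWeight (v : ι → ℂ) : ℝ := Real.exp (-∑ i, ‖v i‖ ^ 2)

/-- The multinomial theorem turns the integrand into a sum of products of one-variable functions.
Exponents in `piAntidiag` vanish off `S`, so the product may run over all coordinates. -/
lemma gauss_expand (S : Finset ι) (K : ℕ) (v : ι → ℂ) :
    (∑ i ∈ S, ‖v i‖ ^ 2) ^ K * gaussWeight v =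
      ∑ k ∈ S.piAntidiag K, (Nat.multinomial S k : ℝ) *
        ∏ i, ((‖v i‖ ^ 2) ^ k i * Real.exp (-‖v i‖ ^ 2)) := by
  rw [Finset.sum_pow_eq_sum_piAntidiag, Finset.sum_mul]
  refine Finset.sum_congr rfl fun k hk => ?_
  rw [Finset.mem_piAntidiag] at hk
  rw [Finset.prod_mul_distrib, ← Real.exp_sum, Finset.sum_neg_distrib, mul_assoc]
  congr 2
  apply Finset.prod_subset (Finset.subset_univ S)
  intro i _ hi
  have : k i = 0 := by
    by_contra h
    exact hi (hk.2 i h)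
  simp [this]

lemma integrable_gauss_moment (S : Finset ι) (K : ℕ) :
    Integrable fun v : ι → ℂ => (∑ i ∈ S, ‖v i‖ ^ 2) ^ K * gaussWeight v := by
  simp_rw [gauss_expand]
  refine integrable_finsetSum _ fun k _ => Integrable.const_mul ?_ _
  exact Integrable.fintype_prod fun i => integrable_norm_pow_mul_exp (k i)

lemma card_piAntidiag_eq {α : Type*} [DecidableEq α] (S : Finset α) (K : ℕ) :
    (S.piAntidiag K).card = S.card.multichoose K := by
  rw [← Finset.card_finsuppAntidiag_nat_eq_multichoose]
  simp [Finset.finsuppAntidiag]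

/-- The factorials `k i !` from the one-variable integrals cancel the multinomial denominator. Every
exponent thus contributes `π ^ |ι| * K !`, and it remains to count exponents. -/
lemma integral_gauss_moment (S : Finset ι) (K : ℕ) :
    ∫ v : ι → ℂ, (∑ i ∈ S, ‖v i‖ ^ 2) ^ K * gaussWeight v =
      Real.pi ^ Fintype.card ι * (S.card.ascFactorial K : ℝ) := by
  simp_rw [gauss_expand]
  rw [integral_finsetSum _ fun k _ => Integrable.const_mul
    (Integrable.fintype_prod fun i => integrable_norm_pow_mul_exp (k i)) _]
  have h : ∀ k ∈ S.piAntidiag K, ∫ v : ι → ℂ, (Nat.multinomial S k : ℝ) *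
      ∏ i, ((‖v i‖ ^ 2) ^ k i * Real.exp (-‖v i‖ ^ 2)) =
        Real.pi ^ Fintype.card ι * K ! := by
    intro k hk
    rw [Finset.mem_piAntidiag] at hk
    rw [integral_const_mul, integral_fintype_prod_volume_eq_prod
      (fun i (z : ℂ) => (‖z‖ ^ 2) ^ k i * Real.exp (-‖z‖ ^ 2))]
    simp_rw [integral_norm_pow_mul_exp]
    rw [Finset.prod_mul_distrib, Finset.prod_const, Finset.card_univ]
    have h2 : ∏ i, ((k i)! : ℝ) = ∏ i ∈ S, ((k i)! : ℝ) := by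
      symm
      apply Finset.prod_subset (Finset.subset_univ S)
      intro i _ hi
      have : k i = 0 := by
        by_contra h
        exact hi (hk.2 i h)
      simp [this]
    have h3 := Nat.multinomial_spec S k
    rw [hk.1] at h3
    rw [h2, ← h3]
    push_cast
    ring
  rw [Finset.sum_congr rfl h, Finset.sum_const, card_piAntidiag_eq, nsmul_eq_mul]
  have : S.card.multichoose K * K ! = S.card.ascFactorial K := by
    rw [Nat.multichoose_eq]
    rcases Nat.eq_zero_or_pos S.card with h0 | h0
    · rcases K with _ | K
      · simp
      · simp [h0, Nat.zero_ascFactorial]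
    · obtain ⟨n, hn⟩ := Nat.exists_eq_succ_of_ne_zero h0.ne'
      rw [hn, Nat.succ_eq_add_one, Nat.ascFactorial_eq_factorial_mul_choose, mul_comm]
      congr 2
      omega
  rw [← this]
  push_cast
  ring

end Gaussian

/-! ### Moments of Haar random states -/

section HaarMoments

variable {ι : Type} [Fintype ι] [DecidableEq ι]

lemma continuous_partial_norm_sq (S : Finset ι) (K : ℕ) :
    Continuous fun p : UGroup ι × (ι → ℂ) =>
      (∑ x ∈ S, ‖(p.1.1.mulVec p.2) x‖ ^ 2) ^ K := by
  have : Continuous fun p : UGroup ι × (ι → ℂ) => p.1.1.mulVec p.2 :=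
    (continuous_subtype_val.comp continuous_fst).matrix_mulVec continuous_snd
  fun_prop

/-- A nonzero `v` is its norm times a column of some unitary `V`, and right invariance absorbs `V`.
-/
lemma integral_haar_eq_mul (S : Finset ι) (K : ℕ) (i₀ : ι) (v : ι → ℂ) :
    ∫ U : UGroup ι, (∑ x ∈ S, ‖(U.1.mulVec v) x‖ ^ 2) ^ K ∂(haarU ι) =
      (∑ i, ‖v i‖ ^ 2) ^ K *
        ∫ U : UGroup ι, (∑ x ∈ S, ‖U.1 x i₀‖ ^ 2) ^ K ∂(haarU ι) := by
  rcases eq_or_ne v 0 with rfl | hv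
  · rcases K with _ | K <;> simp
  have hpos : 0 < ∑ i, ‖v i‖ ^ 2 := by
    obtain ⟨i, hi⟩ := Function.ne_iff.mp hv
    exact Finset.sum_pos' (fun _ _ => by positivity)
      ⟨i, Finset.mem_univ _, by have := norm_pos_iff.mpr hi; positivity⟩
  set n := ∑ i, ‖v i‖ ^ 2 with hn
  set r : ℝ := Real.sqrt n
  have hr : r ^ 2 = n := Real.sq_sqrt hpos.le
  have hr0 : 0 < r := Real.sqrt_pos.mpr hpos
  obtain ⟨V, hV⟩ := exists_unitary_col i₀ (fun i => (r : ℂ)⁻¹ * v i) (by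
    simp_rw [norm_mul, mul_pow, ← Finset.mul_sum]
    rw [← hn, ← hr]
    simp
    field_simp)
  have hvV : ∀ (U : UGroup ι) x, (U.1.mulVec v) x = r * (U * V).1 x i₀ := by
    intro U x
    have hrc : (r : ℂ) ≠ 0 := by exact_mod_cast hr0.ne'
    simp only [Matrix.mulVec, dotProduct, Submonoid.coe_mul, Matrix.mul_apply, hV,
      Finset.mul_sum]
    refine Finset.sum_congr rfl fun j _ => ?_
    field_simp
  simp_rw [hvV, norm_mul, mul_pow, ← Finset.mul_sum, mul_pow]
  rw [integral_const_mul, integral_mul_right_eq_self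
    (fun U : UGroup ι => (∑ x ∈ S, ‖U.1 x i₀‖ ^ 2) ^ K)]
  simp [hr]

/-- Moments of the total weight on a set of outcomes of a Haar random state. -/
theorem integral_haar_partial_norm_sq [Nonempty ι] (S : Finset ι) (K : ℕ) (v : ι → ℂ) :
    ∫ U : UGroup ι, (∑ x ∈ S, ‖(U.1.mulVec v) x‖ ^ 2) ^ K ∂(haarU ι) =
      (∑ i, ‖v i‖ ^ 2) ^ K *
        ((S.card.ascFactorial K : ℝ) / ((Fintype.card ι).ascFactorial K : ℝ)) := by
  obtain ⟨i₀⟩ := ‹Nonempty ι›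
  rw [integral_haar_eq_mul S K i₀]
  congr 1
  set c := ∫ U : UGroup ι, (∑ x ∈ S, ‖U.1 x i₀‖ ^ 2) ^ K ∂(haarU ι) with hc
  let F : UGroup ι → (ι → ℂ) → ℝ := fun U v =>
    (∑ x ∈ S, ‖(U.1.mulVec v) x‖ ^ 2) ^ K * gaussWeight v
  have hw : Continuous (gaussWeight : (ι → ℂ) → ℝ) := by unfold gaussWeight; fun_prop
  have hFc : Continuous (Function.uncurry F) :=
    (continuous_partial_norm_sq S K).mul (hw.comp continuous_snd)
  have hFi : Integrable (Function.uncurry F) ((haarU ι).prod volume) := by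
    -- The partial norm of `U v` is at most the norm of `v`, which gives a dominating function
    -- independent of `U`.
    have hg := (integrable_gauss_moment (Finset.univ : Finset ι) K).comp_snd (haarU ι)
    refine hg.mono' hFc.aestronglyMeasurable (Filter.Eventually.of_forall fun p => ?_)
    have h1 : ∑ x ∈ S, ‖(p.1.1.mulVec p.2) x‖ ^ 2 ≤ ∑ i, ‖p.2 i‖ ^ 2 := by
      rw [← sum_norm_sq_unitary_mulVec p.1 p.2]
      exact Finset.sum_le_sum_of_subset_of_nonneg (Finset.subset_univ _)
        fun _ _ _ => by positivity
    have h0 : 0 ≤ gaussWeight p.2 := (Real.exp_pos _).le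
    have h2 : 0 ≤ ∑ x ∈ S, ‖(p.1.1.mulVec p.2) x‖ ^ 2 :=
      Finset.sum_nonneg fun _ _ => by positivity
    simp only [Function.uncurry, F]
    rw [Real.norm_of_nonneg (by positivity)]
    gcongr
  have hswap := integral_integral_swap hFi
  have hleft : ∀ U : UGroup ι, ∫ v, F U v =
      Real.pi ^ Fintype.card ι * (S.card.ascFactorial K : ℝ) := by
    intro U
    rw [← integral_gauss_moment, ← integral_unitary_mulVec U
      (fun v => (∑ i ∈ S, ‖v i‖ ^ 2) ^ K * gaussWeight v) (by fun_prop)]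
    simp only [F, gaussWeight, sum_norm_sq_unitary_mulVec]
  have hright : ∀ v, ∫ U, F U v ∂(haarU ι) = c * ((∑ i, ‖v i‖ ^ 2) ^ K * gaussWeight v) := by
    intro v
    simp only [F]
    rw [integral_mul_const, integral_haar_eq_mul S K i₀]
    ring
  simp_rw [hleft, hright] at hswap
  rw [integral_const_mul c, integral_gauss_moment] at hswap
  simp only [integral_const, probReal_univ, one_smul, Finset.card_univ] at hswap
  have hne : ((Fintype.card ι).ascFactorial K : ℝ) ≠ 0 := by
    have hp : 0 < Fintype.card ι := Fintype.card_pos_iff.mpr ⟨i₀⟩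
    obtain ⟨n, hn⟩ := Nat.exists_eq_succ_of_ne_zero hp.ne'
    rw [hn]
    exact_mod_cast (Nat.ascFactorial_pos n K).ne'
  rw [eq_div_iff hne]
  have hpi : Real.pi ^ Fintype.card ι ≠ 0 := by positivity
  apply mul_left_cancel₀ hpi
  rw [hswap]
  ring

end HaarMoments

/-! ### From Haar measure to designs -/

section Designs

variable {ι : Type} [Fintype ι] [DecidableEq ι]

instance secondCountable_UGroup : SecondCountableTopology (UGroup ι) := by
  have : SecondCountableTopology (Matrix ι ι ℂ) :=
    inferInstanceAs (SecondCountableTopology (ι → ι → ℂ))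
  exact Topology.IsEmbedding.subtypeVal.secondCountableTopology

lemma integrable_of_continuous {X E : Type*} [TopologicalSpace X] [CompactSpace X]
    [MeasurableSpace X] [OpensMeasurableSpace X] [NormedAddCommGroup E]
    [SecondCountableTopologyEither X E]
    (μ : Measure X) [IsFiniteMeasure μ] {f : X → E} (hf : Continuous f) : Integrable f μ :=
  hf.integrable_of_hasCompactSupport (HasCompactSupport.of_compactSpace f)

/-- The monomials on the right are exactly those whose integrals `IsDesign` prescribes. -/
lemma partial_norm_sq_expand (S : Finset ι) (K : ℕ) (v : ι → ℂ) (U : UGroup ι) :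
    (((∑ x ∈ S, ‖(U.1.mulVec v) x‖ ^ 2) ^ K : ℝ) : ℂ) =
      ∑ p : Fin K → S × ι × ι, (∏ a, v (p a).2.1 * conj (v (p a).2.2)) *
        ((∏ a, U.1 (p a).1 (p a).2.1) * ∏ a, conj (U.1 (p a).1 (p a).2.2)) := by
  have h : ((∑ x ∈ S, ‖(U.1.mulVec v) x‖ ^ 2 : ℝ) : ℂ) =
      ∑ q : S × ι × ι, (v q.2.1 * conj (v q.2.2)) *
        (U.1 q.1 q.2.1 * conj (U.1 q.1 q.2.2)) := by
    rw [Fintype.sum_prod_type, ← Finset.sum_coe_sort S]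
    push_cast
    refine Finset.sum_congr rfl fun x _ => ?_
    rw [Fintype.sum_prod_type, ← Complex.mul_conj']
    simp only [Matrix.mulVec, dotProduct, map_sum, map_mul]
    rw [Finset.sum_mul_sum]
    refine Finset.sum_congr rfl fun j _ => Finset.sum_congr rfl fun l _ => ?_
    ring
  rw [Complex.ofReal_pow, h, Fintype.sum_pow]
  simp only [Finset.prod_mul_distrib]

lemma integral_design_eq_haar {K : ℕ} {ν : Measure (UGroup ι)} [IsProbabilityMeasure ν]
    (hν : IsDesign K ν) (S : Finset ι) (v : ι → ℂ) :
    ∫ U : UGroup ι, (∑ x ∈ S, ‖(U.1.mulVec v) x‖ ^ 2) ^ K ∂ν =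
      ∫ U : UGroup ι, (∑ x ∈ S, ‖(U.1.mulVec v) x‖ ^ 2) ^ K ∂(haarU ι) := by
  have hcont : ∀ p : Fin K → S × ι × ι, Continuous fun U : UGroup ι =>
      (∏ a, v (p a).2.1 * conj (v (p a).2.2)) *
        ((∏ a, U.1 (p a).1 (p a).2.1) * ∏ a, conj (U.1 (p a).1 (p a).2.2)) := by
    intro p
    have : ∀ i j, Continuous fun U : UGroup ι => U.1 i j := fun i j =>
      continuous_subtype_val.matrix_elem i j
    refine continuous_const.mul ((continuous_finsetProd _ fun a _ => this _ _).mul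
      (continuous_finsetProd _ fun a _ => Complex.continuous_conj.comp (this _ _)))
  apply Complex.ofReal_injective
  rw [← integral_complex_ofReal, ← integral_complex_ofReal]
  simp_rw [partial_norm_sq_expand]
  rw [integral_finsetSum _ fun p _ => integrable_of_continuous ν (hcont p),
    integral_finsetSum _ fun p _ => integrable_of_continuous (haarU ι) (hcont p)]
  refine Finset.sum_congr rfl fun p _ => ?_
  rw [integral_const_mul, integral_const_mul,
    hν (fun a => (p a).1) (fun a => (p a).2.1) (fun a => (p a).1) (fun a => (p a).2.2)]

end Designs

/-! ### Moments of a single branch of the circuit -/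

section Blocks

variable {A B : Type} [Fintype A] [DecidableEq A] [Fintype B] [DecidableEq B]

/-- The operator on the system obtained when the bath enters in the state `b` and is found in the
state `z`. -/
def block (U : UGroup (A × B)) (z b : B) : Matrix A A ℂ := fun x y => U.1 (x, z) (y, b)

lemma block_mulVec (U : UGroup (A × B)) (z b : B) (v : A → ℂ) (x : A) :
    ((block U z b).mulVec v) x =
      (U.1.mulVec fun q => if q.2 = b then v q.1 else 0) (x, z) := by
  simp [Matrix.mulVec, dotProduct, block, Fintype.sum_prod_type]

lemma continuous_block (z b : B) : Continuous fun U : UGroup (A × B) => block U z b :=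
  continuous_matrix fun _ _ => continuous_subtype_val.matrix_elem _ _

/-- One step of the circuit, for an arbitrary incoming state and set of system outcomes. -/
lemma integral_block_moment [Nonempty A] [Nonempty B] {K : ℕ} {ν : Measure (UGroup (A × B))}
    [IsProbabilityMeasure ν] (hν : IsDesign K ν) (T : Finset A) (z b : B) (v : A → ℂ) :
    ∫ U : UGroup (A × B), (∑ x ∈ T, ‖((block U z b).mulVec v) x‖ ^ 2) ^ K ∂ν =
      (∑ i, ‖v i‖ ^ 2) ^ K * ((T.card.ascFactorial K : ℝ) /
        ((Fintype.card A * Fintype.card B).ascFactorial K : ℝ)) := by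
  -- The step is `U` applied to `v ⊗ |b⟩`, observed on the outcomes `T × {z}`.
  have h := integral_design_eq_haar hν (T.map ⟨fun x => (x, z), Prod.mk_left_injective z⟩)
    (fun q => if q.2 = b then v q.1 else 0)
  rw [integral_haar_partial_norm_sq] at h
  simp only [Finset.sum_map, Function.Embedding.coeFn_mk, Finset.card_map, Fintype.card_prod] at h
  simp_rw [block_mulVec, h]
  congr 2
  rw [Fintype.sum_prod_type]
  refine Finset.sum_congr rfl fun x _ => ?_
  simp [apply_ite]

/-- The amplitude operator of the whole circuit on the system, for given bath outcomes `z` and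
bath inputs `b`. -/
def branchOp {t : ℕ} (z b : Fin t → B) (U : Fin t → UGroup (A × B)) : Matrix A A ℂ :=
  (List.ofFn fun k => block (U k) (z k) (b k)).reverse.prod

lemma continuous_branchOp {t : ℕ} (z b : Fin t → B) :
    Continuous fun U : Fin t → UGroup (A × B) => branchOp z b U := by
  simp only [branchOp, List.ofFn_eq_map, ← List.map_reverse]
  exact continuous_list_prod _ fun k _ => (continuous_block _ _).comp (continuous_apply k)

lemma branchOp_cons_mulVec {t : ℕ} (z b : Fin (t + 1) → B) (u : UGroup (A × B))
    (U : Fin t → UGroup (A × B)) (v : A → ℂ) :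
    (branchOp z b (Fin.cons u U : Fin (t + 1) → UGroup (A × B))).mulVec v =
      (branchOp (Fin.tail z) (Fin.tail b) U).mulVec ((block u (z 0) (b 0)).mulVec v) := by
  simp [branchOp, List.ofFn_succ, Fin.tail]

lemma integral_pi_succ {X : Type*} [TopologicalSpace X] [CompactSpace X]
    [SecondCountableTopology X] [MeasurableSpace X] [BorelSpace X] {t : ℕ}
    (ν : Fin (t + 1) → Measure X) [∀ k, IsProbabilityMeasure (ν k)]
    (f : (Fin (t + 1) → X) → ℝ) (hf : Continuous f) :
    ∫ U, f U ∂(Measure.pi ν) =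
      ∫ u, ∫ U, f (Fin.cons u U) ∂(Measure.pi fun k => ν k.succ) ∂(ν 0) := by
  have hmp := (measurePreserving_piFinSuccAbove ν 0).symm
  rw [← hmp.integral_comp' f]
  simp only [Fin.zero_succAbove]
  have hcont : Continuous fun p : X × (Fin t → X) =>
      f (Fin.cons (α := fun _ => X) p.1 p.2) :=
    hf.comp (Continuous.finCons continuous_fst continuous_snd)
  have := integral_prod _ (integrable_of_continuous
    ((ν 0).prod (Measure.pi fun k => ν k.succ)) hcont)
  rw [← this]
  simp [Fin.consEquiv]

lemma continuous_branchOp_moment (K : ℕ) {t : ℕ} (z b : Fin t → B) (x : A) (v : A → ℂ) :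
    Continuous fun U : Fin t → UGroup (A × B) => (‖((branchOp z b U).mulVec v) x‖ ^ 2) ^ K := by
  have : Continuous fun U => (branchOp z b U).mulVec v :=
    (continuous_branchOp z b).matrix_mulVec continuous_const
  fun_prop

/-- Induction peels off the first step, with `v` arbitrary: by hypothesis the later steps see only
the norm of the vector handed to them, and `integral_block_moment` averages that norm. -/
lemma integral_branchOp_moment [Nonempty A] [Nonempty B] {K : ℕ} (n : ℕ)
    (ν : Fin (n + 1) → Measure (UGroup (A × B))) [∀ k, IsProbabilityMeasure (ν k)]
    (hν : ∀ k, IsDesign K (ν k)) (z b : Fin (n + 1) → B) (x : A) (v : A → ℂ) :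
    ∫ U, (‖((branchOp z b U).mulVec v) x‖ ^ 2) ^ K ∂(Measure.pi ν) =
      (∑ i, ‖v i‖ ^ 2) ^ K *
        ((((Fintype.card A).ascFactorial K : ℝ) /
            ((Fintype.card A * Fintype.card B).ascFactorial K : ℝ)) ^ n *
          ((K ! : ℝ) / ((Fintype.card A * Fintype.card B).ascFactorial K : ℝ))) := by
  induction n generalizing v with
  | zero =>
    rw [integral_pi_succ ν _ (continuous_branchOp_moment K z b x v)]
    simp_rw [branchOp_cons_mulVec]
    -- The final step resolves the single outcome `x`; the rising factorial of `1` is `K !`.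
    have h := integral_block_moment (hν 0) {x} (z 0) (b 0) v
    simpa [branchOp, Nat.one_ascFactorial] using h
  | succ n ih =>
    rw [integral_pi_succ ν _ (continuous_branchOp_moment K z b x v)]
    simp_rw [branchOp_cons_mulVec,
      ih (fun k => ν k.succ) (fun k => hν k.succ) (Fin.tail z) (Fin.tail b)]
    rw [integral_mul_const, integral_block_moment (hν 0) Finset.univ (z 0) (b 0) v,
      Finset.card_univ]
    ring

end Blocks

/-! ### The circuit as a sum over branches -/

section Circuit

variable {NA NB t : ℕ}

/-- Since `l` has no repetitions, each bath register is acted on at most once, so no sum over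
intermediate bath states survives. -/
lemma prod_map_liftOp (U : Fin t → UGroup (Bits NA × Bits NB)) (l : List (Fin t)) (hl : l.Nodup)
    (p q : Bits NA × (Fin t → Bits NB)) :
    (l.map fun k => liftOp k (U k)).prod p q =
      if ∀ j, j ∉ l → p.2 j = q.2 j then
        (l.map fun k => block (U k) (p.2 k) (q.2 k)).prod p.1 q.1 else 0 := by
  induction l generalizing p with
  | nil =>
    simp only [List.map_nil, List.prod_nil, Matrix.one_apply, List.not_mem_nil,
      not_false_eq_true, forall_const, ← funext_iff, Prod.ext_iff]
    by_cases h1 : p.1 = q.1 <;> by_cases h2 : p.2 = q.2 <;> simp [h1, h2]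
  | cons k l ih =>
    rw [List.nodup_cons] at hl
    simp only [List.map_cons, List.prod_cons, Matrix.mul_apply]
    rw [Fintype.sum_prod_type]
    have hinner : ∀ y : Bits NA, ∑ w : Fin t → Bits NB,
        liftOp k (U k) p (y, w) * (l.map fun k => liftOp k (U k)).prod (y, w) q =
        if ∀ j, j ∉ k :: l → p.2 j = q.2 j then
          block (U k) (p.2 k) (q.2 k) p.1 y *
            (l.map fun k => block (U k) (p.2 k) (q.2 k)).prod y q.1 else 0 := by
      intro y
      -- The head changes only register `k`, and the tail never touches it: the intermediate state
      -- agrees with `p` off `k` and with `q` at `k`.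
      rw [Finset.sum_eq_single (Function.update p.2 k (q.2 k))]
      · rw [ih hl.2]
        have h1 : liftOp k (U k) p (y, Function.update p.2 k (q.2 k)) =
            block (U k) (p.2 k) (q.2 k) p.1 y := by
          simp only [liftOp, block, Function.update_self]
          rw [if_pos fun j hj => by simp [hj]]
        have h2 : (l.map fun j => block (U j) (Function.update p.2 k (q.2 k) j) (q.2 j)) =
            l.map fun k => block (U k) (p.2 k) (q.2 k) := by
          refine List.map_congr_left fun j hj => ?_
          rw [Function.update_of_ne (ne_of_mem_of_not_mem hj hl.1)]
        have h3 : (∀ j, j ∉ l → Function.update p.2 k (q.2 k) j = q.2 j) ↔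
            ∀ j, j ∉ k :: l → p.2 j = q.2 j := by
          constructor
          · intro h j hj
            rw [List.mem_cons, not_or] at hj
            have := h j hj.2
            rwa [Function.update_of_ne hj.1] at this
          · intro h j hj
            by_cases hjk : j = k
            · subst hjk
              simp
            · rw [Function.update_of_ne hjk]
              exact h j (by simp [hjk, hj])
        simp only [h1, h2, h3, mul_ite, mul_zero]
      · intro w _ hw
        rw [ih hl.2]
        simp only [liftOp]
        by_contra hne
        apply hw
        have hc1 : ∀ j, j ≠ k → p.2 j = w j := by
          by_contra h
          exact hne (by rw [if_neg h, zero_mul])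
        have hc2 : ∀ j, j ∉ l → w j = q.2 j := by
          by_contra h
          exact hne (by rw [if_neg h, mul_zero])
        funext j
        by_cases hjk : j = k
        · subst hjk
          simpa using hc2 j hl.1
        · rw [Function.update_of_ne hjk, hc1 j hjk]
      · simp
    simp_rw [hinner]
    split_ifs <;> simp

lemma globalOp_apply (U : Fin t → UGroup (Bits NA × Bits NB)) (x y : Bits NA)
    (z b : Fin t → Bits NB) : globalOp U (x, z) (y, b) = branchOp z b U x y := by
  have h := prod_map_liftOp U (List.finRange t).reverse
    (List.nodup_reverse.mpr (List.nodup_finRange t)) (x, z) (y, b)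
  simpa [globalOp, branchOp, List.ofFn_eq_map, ← List.map_reverse] using h

lemma card_bits (N : ℕ) : Fintype.card (Bits N) = 2 ^ N := by simp

theorem haarPowerSum_eq_ascFactorial (K N : ℕ) :
    haarPowerSum K N = 2 ^ N * ((K ! : ℝ) / ((2 ^ N).ascFactorial K : ℝ)) := by
  have h : ∀ x : Bits N, ∫ U : UGroup (Bits N), (‖U.1 x 0‖ ^ 2) ^ K ∂(haarU (Bits N)) =
      (K ! : ℝ) / ((2 ^ N).ascFactorial K : ℝ) := by
    intro x
    have := integral_haar_partial_norm_sq {x} K (Pi.single (0 : Bits N) (1 : ℂ))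
    rw [card_bits] at this
    have hs : ∑ i, ‖(Pi.single (0 : Bits N) (1 : ℂ) : Bits N → ℂ) i‖ ^ 2 = 1 := by
      rw [Finset.sum_eq_single 0] <;> simp +contextual
    rw [hs] at this
    simpa [Nat.one_ascFactorial] using this
  have hc : ∀ x : Bits N, Continuous fun U : UGroup (Bits N) => (‖U.1 x 0‖ ^ 2) ^ K :=
    fun x => (((continuous_subtype_val.matrix_elem x 0).norm).pow 2).pow K
  rw [haarPowerSum, integral_finsetSum _ fun x _ => integrable_of_continuous _ (hc x)]
  simp_rw [h]
  simp

theorem powerSum_eq_ascFactorial {K : ℕ} (n : ℕ) (reset : Fin (n + 1) → Bool)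
    (ν : Fin (n + 1) → Measure (UGroup (Bits NA × Bits NB))) [∀ k, IsProbabilityMeasure (ν k)]
    (hν : ∀ k, IsDesign K (ν k)) :
    powerSum K reset ν = (2 ^ NB) ^ (n + 1) * 2 ^ NA *
      ((((2 ^ NA).ascFactorial K : ℝ) / ((2 ^ NA * 2 ^ NB).ascFactorial K : ℝ)) ^ n *
        ((K ! : ℝ) / ((2 ^ NA * 2 ^ NB).ascFactorial K : ℝ))) := by
  have hs : ∑ i, ‖(Pi.single (0 : Bits NA) (1 : ℂ) : Bits NA → ℂ) i‖ ^ 2 = 1 := by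
    rw [Finset.sum_eq_single 0] <;> simp +contextual
  have h : ∀ z x, ∫ U, jointProb reset U z x ^ K ∂(Measure.pi ν) =
      (((2 ^ NA).ascFactorial K : ℝ) / ((2 ^ NA * 2 ^ NB).ascFactorial K : ℝ)) ^ n *
        ((K ! : ℝ) / ((2 ^ NA * 2 ^ NB).ascFactorial K : ℝ)) := fun z x => by
    have := integral_branchOp_moment n ν hν z (bathInput reset z) x (Pi.single 0 1)
    rw [hs, card_bits, card_bits, one_pow, one_mul] at this
    simpa [jointProb, globalOp_apply] using this
  have hc : ∀ z x, Continuous fun U => jointProb (NA := NA) (NB := NB) reset U z x ^ K := by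
    intro z x
    simp only [jointProb, globalOp_apply]
    exact ((((continuous_branchOp _ _).matrix_elem x 0).norm).pow 2).pow K
  have hi := fun z x => integrable_of_continuous (Measure.pi ν) (hc z x)
  have hz : ∀ z, ∫ U, ∑ x, jointProb (NA := NA) reset U z x ^ K ∂(Measure.pi ν) =
      2 ^ NA * ((((2 ^ NA).ascFactorial K : ℝ) / ((2 ^ NA * 2 ^ NB).ascFactorial K : ℝ)) ^ n *
        ((K ! : ℝ) / ((2 ^ NA * 2 ^ NB).ascFactorial K : ℝ))) := fun z => by
    rw [integral_finsetSum _ fun x _ => hi z x, Finset.sum_congr rfl fun x _ => h z x]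
    simp
  rw [powerSum, integral_finsetSum _ fun z _ => integrable_finsetSum _ fun x _ => hi z x,
    Finset.sum_congr rfl fun z _ => hz z]
  simp
  ring

end Circuit

/-! ### Asymptotics of rising factorials -/

section Asymptotics

lemma ascFactorial_eq_div (m K : ℕ) (hm : 0 < m) :
    (m.ascFactorial K : ℝ) = ((m + K - 1 : ℕ)! : ℝ) / ((m - 1 : ℕ)! : ℝ) := by
  obtain ⟨n, rfl⟩ := Nat.exists_eq_succ_of_ne_zero hm.ne'
  have h := Nat.factorial_mul_ascFactorial n K
  have h1 : n.succ + K - 1 = n + K := by omega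
  rw [h1, Nat.succ_sub_one, ← h]
  have : (n ! : ℝ) ≠ 0 := by positivity
  push_cast
  field_simp

lemma abs_log_one_add_sub_le {x : ℝ} (hx : 0 ≤ x) : |Real.log (1 + x) - x| ≤ x ^ 2 := by
  have h1 : Real.log (1 + x) ≤ x := by
    have := Real.log_le_sub_one_of_pos (x := 1 + x) (by linarith)
    linarith
  have h2 : 1 - (1 + x)⁻¹ ≤ Real.log (1 + x) := Real.one_sub_inv_le_log_of_pos (by linarith)
  have h3 : x - x ^ 2 ≤ 1 - (1 + x)⁻¹ := by
    have h4 : 1 - (1 + x)⁻¹ = x / (1 + x) := by field_simp; ring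
    rw [h4, le_div_iff₀ (by linarith)]
    nlinarith [pow_nonneg hx 3]
  rw [abs_le]
  constructor <;> nlinarith [sq_nonneg x]

/-- The second-order remainder in the logarithm of the rising factorial of `m`. -/
def logRemainder (K : ℕ) (m : ℝ) : ℝ :=
  ∑ j ∈ Finset.range K, (Real.log (1 + j / m) - j / m)

lemma abs_logRemainder_le (K : ℕ) {m : ℝ} (hm : 0 < m) :
    |logRemainder K m| ≤ (∑ j ∈ Finset.range K, (j : ℝ) ^ 2) / m ^ 2 := by
  refine (Finset.abs_sum_le_sum_abs _ _).trans ?_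
  rw [Finset.sum_div]
  refine Finset.sum_le_sum fun j _ => ?_
  rw [← div_pow]
  exact abs_log_one_add_sub_le (by positivity)

/-- Pull `m` out of each factor `m + j`; the linear terms `j / m` of the logarithms add up to
`K(K-1)/(2m)`. -/
lemma ascFactorial_eq_exp (K m : ℕ) (hm : 0 < m) :
    (m.ascFactorial K : ℝ) =
      (m : ℝ) ^ K * Real.exp ((K : ℝ) * (K - 1) / 2 / m + logRemainder K m) := by
  have hm' : (0 : ℝ) < m := by exact_mod_cast hm
  have hsum : (K : ℝ) * (K - 1) / 2 / m = ∑ j ∈ Finset.range K, (j : ℝ) / m := by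
    rw [← Finset.sum_div]
    congr 1
    induction K with
    | zero => simp
    | succ K ih => rw [Finset.sum_range_succ, ← ih]; push_cast; ring
  rw [hsum, logRemainder, ← Finset.sum_add_distrib]
  simp only [add_sub_cancel]
  rw [Real.exp_sum, Nat.ascFactorial_eq_prod_range, ← Finset.card_range K, ← Finset.prod_const,
    Finset.card_range, ← Finset.prod_mul_distrib]
  push_cast
  refine Finset.prod_congr rfl fun j _ => ?_
  rw [Real.exp_log (by positivity)]
  field_simp

/-- Comparison of rising factorials behind the comparison of the circuit with Haar states. -/
lemma ascFactorial_comparison (K n a d : ℕ) (ha : 0 < a) (hd : 0 < d) :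
    ∃ r : ℝ, |r| ≤ 2 * (∑ j ∈ Finset.range K, (j : ℝ) ^ 2) * (n + 1 : ℕ) / (a : ℝ) ^ 2 ∧
      (a.ascFactorial K : ℝ) ^ n * ((a * d ^ (n + 1)).ascFactorial K : ℝ) =
        ((a * d).ascFactorial K : ℝ) ^ (n + 1) *
          Real.exp ((K : ℝ) * ((K : ℝ) - 1) *
            (((n + 1 : ℕ) : ℝ) * (1 - (d : ℝ)⁻¹) + ((d : ℝ) ^ (n + 1))⁻¹ - 1) /
              (2 * a) + r) := by
  set Q : ℝ := ∑ j ∈ Finset.range K, (j : ℝ) ^ 2 with hQ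
  have hQ0 : 0 ≤ Q := Finset.sum_nonneg fun _ _ => by positivity
  have ha' : (0 : ℝ) < a := by exact_mod_cast ha
  have hd' : (1 : ℝ) ≤ d := by exact_mod_cast hd
  have hd0 : (0 : ℝ) < d := by linarith
  have hbound : ∀ c : ℝ, 1 ≤ c → |logRemainder K (a * c)| ≤ Q / (a : ℝ) ^ 2 := by
    intro c hc
    refine (abs_logRemainder_le K (by positivity)).trans ?_
    gcongr
    nlinarith
  have b1 := hbound 1 le_rfl
  have b2 := hbound d hd'
  have b3 := hbound ((d : ℝ) ^ (n + 1)) (one_le_pow₀ hd')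
  rw [mul_one] at b1
  -- The remainders carry the exponents of their rising factorials. Each is at most `Q / a ^ 2`, and
  -- `n + (n + 1) + 1 = 2 * (n + 1)`.
  refine ⟨n * logRemainder K a - (n + 1) * logRemainder K (a * d) +
    logRemainder K (a * (d : ℝ) ^ (n + 1)), ?_, ?_⟩
  · have hn : (0 : ℝ) ≤ n := Nat.cast_nonneg n
    calc _ ≤ |(n : ℝ) * logRemainder K a| + |((n : ℝ) + 1) * logRemainder K (a * d)| +
          |logRemainder K (a * (d : ℝ) ^ (n + 1))| :=
          (abs_add_le _ _).trans (add_le_add_left (abs_sub _ _) _)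
      _ = n * |logRemainder K a| + (n + 1) * |logRemainder K (a * d)| +
          |logRemainder K (a * (d : ℝ) ^ (n + 1))| := by
          rw [abs_mul, abs_mul, abs_of_nonneg hn, abs_of_nonneg (by linarith : (0 : ℝ) ≤ n + 1)]
      _ ≤ n * (Q / (a : ℝ) ^ 2) + (n + 1) * (Q / (a : ℝ) ^ 2) + Q / (a : ℝ) ^ 2 := by gcongr
      _ = _ := by push_cast; ring
  · rw [ascFactorial_eq_exp K a ha, ascFactorial_eq_exp K _ (by positivity),
      ascFactorial_eq_exp K (a * d) (by positivity)]
    push_cast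
    rw [mul_pow _ _ n, mul_pow _ _ (n + 1), ← Real.exp_nat_mul, ← Real.exp_nat_mul]
    have hp : ((a : ℝ) ^ K) ^ n * ((a : ℝ) * (d : ℝ) ^ (n + 1)) ^ K =
        (((a : ℝ) * d) ^ K) ^ (n + 1) := by
      simp only [mul_pow, ← pow_mul]
      ring
    rw [mul_mul_mul_comm, hp, ← Real.exp_add, mul_assoc, ← Real.exp_add]
    congr 2
    push_cast
    field_simp
    ring

end Asymptotics

end

end HRCS

/-! ### Assembly -/

theorem theorem2 (K : ℕ) :
    -- the power sum of `N`-qubit Haar random states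
    (∀ N : ℕ, HRCS.haarPowerSum K N =
      (K ! : ℝ) * ((2 ^ N : ℕ)! : ℝ) / ((2 ^ N + K - 1 : ℕ)! : ℝ)) ∧
    -- the exact power sum of the joint distribution
    (∀ (NA NB t : ℕ), 1 ≤ t → ∀ (reset : Fin t → Bool)
      (ν : Fin t → Measure (HRCS.UGroup (HRCS.Bits NA × HRCS.Bits NB))),
      (∀ k, IsProbabilityMeasure (ν k)) → (∀ k, HRCS.IsDesign K (ν k)) →
      HRCS.powerSum K reset ν =
        (K ! : ℝ) * 2 ^ NA * (2 ^ NB) ^ t *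
          (((2 ^ NA + K - 1 : ℕ)! : ℝ) / ((2 ^ NA - 1 : ℕ)! : ℝ)) ^ (t - 1) *
          (((2 ^ NA * 2 ^ NB - 1 : ℕ)! : ℝ) / ((2 ^ NA * 2 ^ NB + K - 1 : ℕ)! : ℝ)) ^ t) ∧
    -- the comparison with Haar random states on `NA + t * NB` qubits
    (∃ C : ℝ, ∀ (NA NB t : ℕ), 1 ≤ t → ∀ (reset : Fin t → Bool)
      (ν : Fin t → Measure (HRCS.UGroup (HRCS.Bits NA × HRCS.Bits NB))),
      (∀ k, IsProbabilityMeasure (ν k)) → (∀ k, HRCS.IsDesign K (ν k)) →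
      ∃ r : ℝ, |r| ≤ C * t / (2 ^ NA) ^ 2 ∧
        HRCS.powerSum K reset ν = HRCS.haarPowerSum K (NA + t * NB) *
          Real.exp ((K : ℝ) * ((K : ℝ) - 1) *
            ((t : ℝ) * (1 - ((2 : ℝ) ^ NB)⁻¹) + (((2 : ℝ) ^ NB) ^ t)⁻¹ - 1) /
              (2 * 2 ^ NA) + r)) := by
  refine ⟨fun N => ?_, fun NA NB t ht reset ν hP hD => ?_,
    2 * ∑ j ∈ Finset.range K, (j : ℝ) ^ 2, fun NA NB t ht reset ν hP hD => ?_⟩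
  · rw [HRCS.haarPowerSum_eq_ascFactorial,
      HRCS.ascFactorial_eq_div _ _ (by positivity), div_div_eq_mul_div,
      ← Nat.mul_factorial_pred (n := 2 ^ N) (by positivity)]
    push_cast
    ring
  · obtain ⟨n, rfl⟩ : ∃ n, t = n + 1 := ⟨t - 1, by omega⟩
    rw [HRCS.powerSum_eq_ascFactorial n reset ν hD, Nat.add_sub_cancel,
      HRCS.ascFactorial_eq_div (2 ^ NA) K (by positivity),
      HRCS.ascFactorial_eq_div (2 ^ NA * 2 ^ NB) K (by positivity)]
    -- This quotient occurs identically on both sides and is kept opaque for `field_simp`.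
    generalize (((2 ^ NA + K - 1 : ℕ)! : ℝ) / ((2 ^ NA - 1 : ℕ)! : ℝ)) = x
    simp only [div_pow, pow_succ]
    field_simp
  · obtain ⟨n, rfl⟩ : ∃ n, t = n + 1 := ⟨t - 1, by omega⟩
    obtain ⟨r, hr, h⟩ := HRCS.ascFactorial_comparison K n (2 ^ NA) (2 ^ NB)
      (by positivity) (by positivity)
    refine ⟨r, by simpa using hr, ?_⟩
    have hpos : ∀ m : ℕ, 0 < m → (m.ascFactorial K : ℝ) ≠ 0 := by
      intro m hm
      obtain ⟨k, rfl⟩ := Nat.exists_eq_succ_of_ne_zero hm.ne'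
      exact_mod_cast (Nat.ascFactorial_pos k K).ne'
    have hD0 := hpos (2 ^ NA * 2 ^ NB) (by positivity)
    have hM0 := hpos (2 ^ NA * (2 ^ NB) ^ (n + 1)) (by positivity)
    have hN : (2 : ℕ) ^ (NA + (n + 1) * NB) = 2 ^ NA * (2 ^ NB) ^ (n + 1) := by
      rw [pow_add, ← pow_mul, mul_comm NB]
    have hN' : (2 : ℝ) ^ (NA + (n + 1) * NB) = 2 ^ NA * (2 ^ NB) ^ (n + 1) := by
      exact_mod_cast hN
    rw [HRCS.powerSum_eq_ascFactorial n reset ν hD,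
      HRCS.haarPowerSum_eq_ascFactorial, hN, hN']
    push_cast at h
    -- Solve the comparison for the exponential, leaving an identity between rational expressions.
    have hE := (eq_div_iff (pow_ne_zero (n + 1) hD0)).mpr ((mul_comm _ _).trans h.symm)
    push_cast
    rw [hE, div_pow]
    field_simp
    ring
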